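/- **Theorem (Cut-elimination for pQLL).** Let $0<p\le\infty$. On $[0,\infty]$ let $a\otimes b$ be multiplication with $0\otimes\infty=0$, let $a^*=1/a$ (with $0^*=\infty$, $\infty^*=0$), $a\otimes^* b=(a^*\otimes b^*)^*$, and, for $p<\infty$, $a\oplus_p b=(a^p+b^p)^{1/p}$ and $a\oplus_p^* b=\big(((a^p)^*+(b^p)^*)^*\big)^{1/p}$, while $a\oplus_\infty b=\max(a,b)$ and $a\oplus^*_\infty b=\min(a,b)$. *Calculi.* Fix a set of formulae. A sequent $\Gamma\vdash\Delta$ is a pair of finite multisets of formulae. Structures are built from sequents and constants $r\in[0,\infty]$ by formal binary connectives $\otimes,\otimes^*,\oplus_p,\oplus_p^*$. A structure is closed if it contains no sequent, and then its validity is the number it evaluates to. A rule is a pair of structures $H/H'$, and a calculus is a set of rules. Derivations in a calculus are generated by: the identity derivation of each structure; the rules; composition of a derivation from $H$ to $I$ with one from $I$ to $K$; and, for each connective $\ast$, combination of derivations from $H_i$ to $K_i$ ($i=1,2$) into one from $H_1\ast H_2$ to $K_1\ast K_2$. A derivation is closed if its top structure is closed; its validity is then that of its top structure. A proof of $\Gamma\vdash\Delta$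 is a closed derivation ending in $\Gamma\vdash\Delta$. The provability $[\![K]\!]_R\in[0,\infty]$ of a structure $K$ in a calculus $R$ (in particular of a sequent) is the supremum of the validities of the closed derivations of $K$ in $R$ (so $0$ if there are none). A rule scheme $S$ is admissible in $R$ if $[\![K]\!]_R=[\![K]\!]_{R\cup S}$ for all structures $K$. *The calculus pQLL.* Formulae over a set $V$ of propositional variables are $A::=a\mid a^\perp\mid \mathbf 1\mid A\otimes A\mid A\parr A\mid\bot\mid\top\mid A\vee A\mid A\wedge A$ with $a\in V$. Negation $A^\perp$ is the involution on formulae that exchanges $a$ with $a^\perp$, $\bot$ with $\top$, $\otimes$ with $\parr$, and $\vee$ with $\wedge$ (negating the arguments of these connectives), and fixes $\mathbf 1$. The rules, written premise $/$ conclusion, are as follows. - Structural: AX: $1\,/\,A\vdash A$; EMP: $1\,/\,\vdash$; EFQ: $0\,/\,\Gamma\vdash\Delta$; CUT: $(\Gamma\vdash A,\Delta)\otimes(\Gamma',A\vdash\Delta')\,/\,\Gamma,\Gamma'\vdash\Delta,\Delta'$; MIX: $(\Gamma\vdash\Delta)\otimes(\Gamma'\vdash\Delta')\,/\,\Gamma,\Gamma'\vdash\Delta,\Delta'$.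 - Multiplicative: $\Gamma,A,B\vdash\Delta\,/\,\Gamma,A\otimes B\vdash\Delta$; $\Gamma\vdash A,B,\Delta\,/\,\Gamma\vdash A\parr B,\Delta$; $(\Gamma,A\vdash\Delta)\otimes(\Gamma',B\vdash\Delta')\,/\,\Gamma,\Gamma',A\parr B\vdash\Delta,\Delta'$; $(\Gamma\vdash A,\Delta)\otimes(\Gamma'\vdash B,\Delta')\,/\,\Gamma,\Gamma'\vdash A\otimes B,\Delta,\Delta'$; $1\,/\,\mathbf 1\vdash$; $1\,/\,\vdash\mathbf 1$; $\Gamma\vdash A,\Delta\,/\,\Gamma,A^\perp\vdash\Delta$; $\Gamma,A\vdash\Delta\,/\,\Gamma\vdash A^\perp,\Delta$. - Additive: $(\Gamma,A\vdash\Delta)\oplus^*_p(\Gamma,B\vdash\Delta)\,/\,\Gamma,A\vee B\vdash\Delta$; $(\Gamma\vdash A,\Delta)\oplus^*_p(\Gamma\vdash B,\Delta)\,/\,\Gamma\vdash A\wedge B,\Delta$; $(\Gamma,A\vdash\Delta)\oplus_p(\Gamma,B\vdash\Delta)\,/\,\Gamma,A\wedge B\vdash\Delta$; $(\Gamma\vdash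 A,\Delta)\oplus_p(\Gamma\vdash B,\Delta)\,/\,\Gamma\vdash A\vee B,\Delta$; $\infty\,/\,\Gamma,\bot\vdash\Delta$; $\infty\,/\,\Gamma\vdash\top,\Delta$. *Claim.* Let $\mathrm{pQLL}^-$ be the calculus obtained from pQLL by removing CUT. Then: 1. for every sequent, $[\![\Gamma\vdash\Delta]\!]_{\mathrm{pQLL}}=[\![\Gamma\vdash\Delta]\!]_{\mathrm{pQLL}^-}$; 2. CUT is admissible in $\mathrm{pQLL}^-$; 3. for every proof $\pi$ of $\Gamma\vdash\Delta$ in pQLL there is a proof of $\Gamma\vdash\Delta$ in $\mathrm{pQLL}^-$ whose validity is at least that of $\pi$. -/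

import Mathlib

open scoped ENNReal

namespace QLL

/-! ## The alethic values: operations on `[0,∞]`

Mathlib's multiplication on `ℝ≥0∞` satisfies `0 * ∞ = 0` (conjunctive multiplication), and its
inversion satisfies `0⁻¹ = ∞`, `∞⁻¹ = 0` (the duality). -/

/-- Disjunctive multiplication, the De Morgan dual of multiplication (`0 ⊗* ∞ = ∞`). -/
noncomputable def cotensor (a b : ℝ≥0∞) : ℝ≥0∞ := (a⁻¹ * b⁻¹)⁻¹

/-- Harmonic sum, the De Morgan dual of the sum. -/
noncomputable def harmonicSum (a b : ℝ≥0∞) : ℝ≥0∞ := (a⁻¹ + b⁻¹)⁻¹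

/-- The `p`-sum for `0 < p ≤ ∞`; for `p = ∞` it is the maximum. -/
noncomputable def pSum (p a b : ℝ≥0∞) : ℝ≥0∞ :=
  if p = ∞ then a ⊔ b else (a ^ p.toReal + b ^ p.toReal) ^ (1 / p.toReal)

/-- The harmonic `p`-sum for `0 < p ≤ ∞`; for `p = ∞` it is the minimum. -/
noncomputable def pHarmonicSum (p a b : ℝ≥0∞) : ℝ≥0∞ :=
  if p = ∞ then a ⊓ b else (harmonicSum (a ^ p.toReal) (b ^ p.toReal)) ^ (1 / p.toReal)

/-! ## Quantitative calculi over a language `Φ` -/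

/-- The connectives combining structures of sequents: `⊗`, `⊗*`, `⊕_p`, `⊕*_p`. -/
inductive Connective where
  | tensor
  | cotensor
  | add
  | coadd

/-- The operation on `[0,∞]` denoted by a connective, at hardness `p`. -/
noncomputable def Connective.eval (p : ℝ≥0∞) : Connective → ℝ≥0∞ → ℝ≥0∞ → ℝ≥0∞
  | .tensor, a, b => a * b
  | .cotensor, a, b => QLL.cotensor a b
  | .add, a, b => pSum p a b
  | .coadd, a, b => pHarmonicSum p a b

/-- Sequents `Γ ⊢ Δ` between finite multisets of formulae. -/
structure Sequent (Φ : Type*) where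
  antecedent : Multiset Φ
  consequent : Multiset Φ

/-- Structures of sequents. -/
inductive SeqStructure (Φ : Type*) where
  | seq (s : Sequent Φ)
  | const (r : ℝ≥0∞)
  | bin (c : Connective) (H K : SeqStructure Φ)

/-- A structure is closed if it involves no sequent. -/
def SeqStructure.Closed {Φ : Type*} : SeqStructure Φ → Prop
  | .seq _ => False
  | .const _ => True
  | .bin _ H K => H.Closed ∧ K.Closed

/-- The validity (alethic value) of a closed structure. -/
noncomputable def SeqStructure.validity {Φ : Type*} (p : ℝ≥0∞) :
    (H : SeqStructure Φ) → H.Closed → ℝ≥0∞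
  | .seq _, h => False.elim h
  | .const r, _ => r
  | .bin c H K, h => c.eval p (H.validity p h.1) (K.validity p h.2)

/-- A rule (instance), from the structure `top` to the structure `bottom`. -/
structure Rule (Φ : Type*) where
  top : SeqStructure Φ
  bottom : SeqStructure Φ

/-- A calculus is a set of rules. -/
abbrev Calculus (Φ : Type*) := Set (Rule Φ)

/-- Derivations in a calculus `R` from a structure to a structure. -/
inductive Derivation {Φ : Type*} (R : Calculus Φ) : SeqStructure Φ → SeqStructure Φ → Type _ where
  | id (H : SeqStructure Φ) : Derivation R H H
  | rule (r : Rule Φ) (hr : r ∈ R) : Derivation R r.top r.bottom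
  | comp {H I K : SeqStructure Φ} (d₁ : Derivation R H I) (d₂ : Derivation R I K) :
      Derivation R H K
  | bin (c : Connective) {H₁ K₁ H₂ K₂ : SeqStructure Φ} (d₁ : Derivation R H₁ K₁)
      (d₂ : Derivation R H₂ K₂) : Derivation R (.bin c H₁ H₂) (.bin c K₁ K₂)

/-- Closed derivations of a structure `K`: those whose top structure is closed. -/
structure ClosedDerivation {Φ : Type*} (R : Calculus Φ) (K : SeqStructure Φ) where
  top : SeqStructure Φ
  closed : top.Closed
  derivation : Derivation R top K

/-- The validity of a closed derivation is that of its top structure. -/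
noncomputable def ClosedDerivation.validity {Φ : Type*} {R : Calculus Φ} {K : SeqStructure Φ}
    (p : ℝ≥0∞) (d : ClosedDerivation R K) : ℝ≥0∞ :=
  d.top.validity p d.closed

/-- A proof of a sequent is a closed derivation of the corresponding unary structure. -/
abbrev Proof {Φ : Type*} (R : Calculus Φ) (s : Sequent Φ) := ClosedDerivation R (.seq s)

/-- The provability of a structure: the supremum of the validities of its closed derivations. -/
noncomputable def structProvability {Φ : Type*} (p : ℝ≥0∞) (R : Calculus Φ)
    (K : SeqStructure Φ) : ℝ≥0∞ :=
  ⨆ d : ClosedDerivation R K, d.validity p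

/-- The provability of a sequent: the supremum of the validities of its proofs. -/
noncomputable def provability {Φ : Type*} (p : ℝ≥0∞) (R : Calculus Φ) (s : Sequent Φ) : ℝ≥0∞ :=
  ⨆ π : Proof R s, π.validity p

/-- A rule scheme `S` (the set of its instances) is admissible in `R` when adding it does not
change the provability of any structure of sequents. -/
def Admissible {Φ : Type*} (p : ℝ≥0∞) (R : Calculus Φ) (S : Set (Rule Φ)) : Prop :=
  ∀ K : SeqStructure Φ, structProvability p R K = structProvability p (R ∪ S) K

/-! ## The calculus `pQLL` -/

/-- Formulae with propositional variables in `V`. -/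
inductive Formula (V : Type*) where
  | var (a : V)
  | negVar (a : V)
  | one
  | tensor (A B : Formula V)
  | par (A B : Formula V)
  | bot
  | top
  | or (A B : Formula V)
  | and (A B : Formula V)

/-- Negation, a syntactic transformation of formulae. -/
def Formula.neg {V : Type*} : Formula V → Formula V
  | .var a => .negVar a
  | .negVar a => .var a
  | .one => .one
  | .tensor A B => .par A.neg B.neg
  | .par A B => .tensor A.neg B.neg
  | .bot => .top
  | .top => .bot
  | .or A B => .and A.neg B.neg
  | .and A B => .or A.neg B.neg

/-- Names of the rules of `pQLL`. -/
inductive RuleName where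
  | ax | emp | efq | cut | mix
  | tensorL | parR | parL | tensorR | oneL | oneR | negL | negR
  | orL | andR | andL | orR | botL | topR

/-- The unary structure `Γ ⊢ Δ`. -/
abbrev sq {V : Type*} (Γ Δ : Multiset (Formula V)) : SeqStructure (Formula V) := .seq ⟨Γ, Δ⟩

/-- `IsInstance n H K` means that `H` over `K` is an instance of the rule named `n`. The rules do
not mention `p`: the connectives `.add` and `.coadd` are evaluated at hardness `p`. -/
inductive IsInstance {V : Type*} :
    RuleName → SeqStructure (Formula V) → SeqStructure (Formula V) → Prop where
  -- structural rules
  | ax (A : Formula V) : IsInstance .ax (.const 1) (sq {A} {A})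
  | emp : IsInstance .emp (.const 1) (sq 0 0)
  | efq (Γ Δ : Multiset (Formula V)) : IsInstance .efq (.const 0) (sq Γ Δ)
  | cut (A : Formula V) (Γ Γ' Δ Δ' : Multiset (Formula V)) :
      IsInstance .cut (.bin .tensor (sq Γ (A ::ₘ Δ)) (sq (A ::ₘ Γ') Δ')) (sq (Γ + Γ') (Δ + Δ'))
  | mix (Γ Γ' Δ Δ' : Multiset (Formula V)) :
      IsInstance .mix (.bin .tensor (sq Γ Δ) (sq Γ' Δ')) (sq (Γ + Γ') (Δ + Δ'))
  -- multiplicative rules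
  | tensorL (A B : Formula V) (Γ Δ : Multiset (Formula V)) :
      IsInstance .tensorL (sq (A ::ₘ B ::ₘ Γ) Δ) (sq (A.tensor B ::ₘ Γ) Δ)
  | parR (A B : Formula V) (Γ Δ : Multiset (Formula V)) :
      IsInstance .parR (sq Γ (A ::ₘ B ::ₘ Δ)) (sq Γ (A.par B ::ₘ Δ))
  | parL (A B : Formula V) (Γ Γ' Δ Δ' : Multiset (Formula V)) :
      IsInstance .parL (.bin .tensor (sq (A ::ₘ Γ) Δ) (sq (B ::ₘ Γ') Δ'))
        (sq (A.par B ::ₘ (Γ + Γ')) (Δ + Δ'))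
  | tensorR (A B : Formula V) (Γ Γ' Δ Δ' : Multiset (Formula V)) :
      IsInstance .tensorR (.bin .tensor (sq Γ (A ::ₘ Δ)) (sq Γ' (B ::ₘ Δ')))
        (sq (Γ + Γ') (A.tensor B ::ₘ (Δ + Δ')))
  | oneL : IsInstance .oneL (.const 1) (sq {.one} 0)
  | oneR : IsInstance .oneR (.const 1) (sq 0 {.one})
  | negL (A : Formula V) (Γ Δ : Multiset (Formula V)) :
      IsInstance .negL (sq Γ (A ::ₘ Δ)) (sq (A.neg ::ₘ Γ) Δ)
  | negR (A : Formula V) (Γ Δ : Multiset (Formula V)) :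
      IsInstance .negR (sq (A ::ₘ Γ) Δ) (sq Γ (A.neg ::ₘ Δ))
  -- additive rules
  | orL (A B : Formula V) (Γ Δ : Multiset (Formula V)) :
      IsInstance .orL (.bin .coadd (sq (A ::ₘ Γ) Δ) (sq (B ::ₘ Γ) Δ)) (sq (A.or B ::ₘ Γ) Δ)
  | andR (A B : Formula V) (Γ Δ : Multiset (Formula V)) :
      IsInstance .andR (.bin .coadd (sq Γ (A ::ₘ Δ)) (sq Γ (B ::ₘ Δ))) (sq Γ (A.and B ::ₘ Δ))
  | andL (A B : Formula V) (Γ Δ : Multiset (Formula V)) :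
      IsInstance .andL (.bin .add (sq (A ::ₘ Γ) Δ) (sq (B ::ₘ Γ) Δ)) (sq (A.and B ::ₘ Γ) Δ)
  | orR (A B : Formula V) (Γ Δ : Multiset (Formula V)) :
      IsInstance .orR (.bin .add (sq Γ (A ::ₘ Δ)) (sq Γ (B ::ₘ Δ))) (sq Γ (A.or B ::ₘ Δ))
  | botL (Γ Δ : Multiset (Formula V)) : IsInstance .botL (.const ∞) (sq (.bot ::ₘ Γ) Δ)
  | topR (Γ Δ : Multiset (Formula V)) : IsInstance .topR (.const ∞) (sq Γ (.top ::ₘ Δ))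

/-- The set of all instances of the rule named `n`. -/
def scheme (V : Type*) (n : RuleName) : Set (Rule (Formula V)) :=
  {r | IsInstance n r.top r.bottom}

/-- The calculus `pQLL`, with all the rules. -/
def pQLL (V : Type*) : Calculus (Formula V) := {r | ∃ n, r ∈ scheme V n}

/-- The calculus obtained by removing `CUT` from `pQLL`. -/
def cutFreePQLL (V : Type*) : Calculus (Formula V) := {r | ∃ n, n ≠ .cut ∧ r ∈ scheme V n}

end QLL

namespace QLL

/-! ## Inequalities between the operations on `[0,∞]` -/

/-! Read `Γ ⊢ Δ` one-sidedly as `⊢ Γ^⊥, Δ` and record a lower bound for the validity of a cut-free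
proof (`OneSided`). Since there is no contraction, cut is eliminated by induction on the cut
formula, with one structural induction over each premise to push the cut up to where the formula is
principal on both sides (`cutAdmissible`).

The numbers follow because multiplication by a constant passes inside both `p`-sums (`pSum_mul_le`,
`pHarmonicSum_mul_le`), and because an additive principal cut loses nothing on its better branch
(`pSum_mul_pHarmonicSum_le`).

Hence every rule of pQLL, CUT included, preserves the bounds (`IsInstance.attains`), and one-sided
bounds are realised by two-sided cut-free derivations (`HasDerivation.of_attains`). -/

lemma pSum_mono (p : ℝ≥0∞) {a b c d : ℝ≥0∞} (h₁ : a ≤ c) (h₂ : b ≤ d) :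
    pSum p a b ≤ pSum p c d := by
  unfold pSum
  split_ifs
  · exact sup_le_sup h₁ h₂
  · gcongr

lemma pHarmonicSum_mono (p : ℝ≥0∞) {a b c d : ℝ≥0∞} (h₁ : a ≤ c) (h₂ : b ≤ d) :
    pHarmonicSum p a b ≤ pHarmonicSum p c d := by
  unfold pHarmonicSum harmonicSum
  split_ifs
  · exact inf_le_inf h₁ h₂
  · gcongr

lemma Connective.eval_mono (p : ℝ≥0∞) (k : Connective) {a b c d : ℝ≥0∞} (h₁ : a ≤ c)
    (h₂ : b ≤ d) : k.eval p a b ≤ k.eval p c d := by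
  cases k with
  | tensor => exact mul_le_mul' h₁ h₂
  | cotensor =>
    exact ENNReal.inv_le_inv.2 (mul_le_mul' (ENNReal.inv_le_inv.2 h₁) (ENNReal.inv_le_inv.2 h₂))
  | add => exact pSum_mono p h₁ h₂
  | coadd => exact pHarmonicSum_mono p h₁ h₂

/-- For `0 < w < ∞` inversion turns the factor `w` into a common factor `w⁻¹` of the sum; the
boundary values are checked separately. -/
lemma harmonicSum_mul_le (a b w : ℝ≥0∞) :
    harmonicSum a b * w ≤ harmonicSum (a * w) (b * w) := by
  unfold harmonicSum
  rcases eq_or_ne a 0 with rfl | ha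
  · simp
  rcases eq_or_ne b 0 with rfl | hb
  · simp
  rcases eq_or_ne w 0 with rfl | hw
  · simp
  rcases eq_or_ne w ∞ with rfl | hw'
  · simp [ENNReal.mul_top, ha, hb]
  rw [ENNReal.mul_inv (.inr hw') (.inr hw), ENNReal.mul_inv (.inr hw') (.inr hw), ← add_mul,
    ENNReal.mul_inv (.inr (ENNReal.inv_ne_top.2 hw)) (.inr (ENNReal.inv_ne_zero.2 hw')), inv_inv]

/-- With `m = max (a * c) (b * d)` one has `a ≤ m / c` and `b ≤ m / d`, so `a + b ≤ m * (c⁻¹ +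
d⁻¹)`. The division needs `c` and `d` nonzero and finite. -/
lemma add_mul_harmonicSum_le (a b c d : ℝ≥0∞) :
    (a + b) * harmonicSum c d ≤ max (a * c) (b * d) := by
  unfold harmonicSum
  rcases eq_or_ne c 0 with rfl | hc
  · simp
  rcases eq_or_ne d 0 with rfl | hd
  · simp
  rcases eq_or_ne a 0 with rfl | ha
  · simpa using mul_le_mul' le_rfl (ENNReal.inv_le_iff_inv_le.2 le_add_self)
  rcases eq_or_ne b 0 with rfl | hb
  · simpa using mul_le_mul' le_rfl (ENNReal.inv_le_iff_inv_le.2 le_self_add)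
  -- Since `a ≠ 0` by now, `a * ∞ = ∞` and the bound is trivial; with `a = 0` it would not be.
  rcases eq_or_ne c ∞ with rfl | hc'
  · simp [ENNReal.mul_top ha]
  rcases eq_or_ne d ∞ with rfl | hd'
  · simp [ENNReal.mul_top hb]
  rw [← div_eq_mul_inv]
  refine ENNReal.div_le_of_le_mul ?_
  have key {x y m : ℝ≥0∞} (hy : y ≠ 0) (hy' : y ≠ ∞) (h : x * y ≤ m) : x ≤ m * y⁻¹ := by
    rw [← div_eq_mul_inv]
    exact (ENNReal.le_div_iff_mul_le (.inl hy) (.inl hy')).2 h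
  rw [mul_add]
  exact add_le_add (key hc hc' (le_max_left _ _)) (key hd hd' (le_max_right _ _))

lemma pSum_mul_le {p : ℝ≥0∞} (hp : 0 < p) (a b w : ℝ≥0∞) :
    pSum p a b * w ≤ pSum p (a * w) (b * w) := by
  unfold pSum
  split_ifs with h
  · rw [max_mul]
  · have hp' : 0 < p.toReal := ENNReal.toReal_pos hp.ne' h
    rw [ENNReal.mul_rpow_of_nonneg _ _ hp'.le, ENNReal.mul_rpow_of_nonneg _ _ hp'.le, ← add_mul,
      ENNReal.mul_rpow_of_nonneg _ _ (by positivity), ← ENNReal.rpow_mul w,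
      mul_one_div_cancel hp'.ne', ENNReal.rpow_one]

lemma pHarmonicSum_mul_le {p : ℝ≥0∞} (hp : 0 < p) (a b w : ℝ≥0∞) :
    pHarmonicSum p a b * w ≤ pHarmonicSum p (a * w) (b * w) := by
  unfold pHarmonicSum
  split_ifs with h
  · exact le_min (mul_le_mul' (min_le_left _ _) le_rfl) (mul_le_mul' (min_le_right _ _) le_rfl)
  · have hp' : 0 < p.toReal := ENNReal.toReal_pos hp.ne' h
    calc _ = (harmonicSum (a ^ p.toReal) (b ^ p.toReal) * w ^ p.toReal) ^ (1 / p.toReal) := by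
          rw [ENNReal.mul_rpow_of_nonneg _ _ (by positivity), ← ENNReal.rpow_mul w,
            mul_one_div_cancel hp'.ne', ENNReal.rpow_one]
      _ ≤ _ := by
          rw [ENNReal.mul_rpow_of_nonneg _ _ hp'.le, ENNReal.mul_rpow_of_nonneg _ _ hp'.le]
          exact ENNReal.rpow_le_rpow (harmonicSum_mul_le _ _ _) (by positivity)

/-- Resolves the cut of `∨` against `∧`: one of the two smaller cuts already reaches the product.
For finite `p`, taking `p`-th powers reduces to `add_mul_harmonicSum_le`. -/
lemma pSum_mul_pHarmonicSum_le {p : ℝ≥0∞} (hp : 0 < p) (a b c d : ℝ≥0∞) :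
    pSum p a b * pHarmonicSum p c d ≤ max (a * c) (b * d) := by
  unfold pSum pHarmonicSum
  split_ifs with h
  · rw [max_mul]
    exact max_le_max (mul_le_mul' le_rfl (min_le_left _ _)) (mul_le_mul' le_rfl (min_le_right _ _))
  · have hp' : 0 < p.toReal := ENNReal.toReal_pos hp.ne' h
    rw [← ENNReal.mul_rpow_of_nonneg _ _ (by positivity), one_div, ENNReal.rpow_inv_le_iff hp',
      (ENNReal.monotone_rpow_of_nonneg hp'.le).map_max, ENNReal.mul_rpow_of_nonneg _ _ hp'.le,
      ENNReal.mul_rpow_of_nonneg _ _ hp'.le]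
    exact add_mul_harmonicSum_le _ _ _ _

/-! ## The one-sided cut-free calculus -/

variable {V : Type*}

lemma Formula.neg_neg (A : Formula V) : A.neg.neg = A := by
  induction A <;> simp_all [Formula.neg]

/-- `OneSided p Γ v` means that the one-sided sequent `⊢ Γ` has a cut-free proof of validity at
least `v`. -/
inductive OneSided (p : ℝ≥0∞) : Multiset (Formula V) → ℝ≥0∞ → Prop where
  | mono {Γ : Multiset (Formula V)} {v w : ℝ≥0∞} (h : OneSided p Γ w) (hvw : v ≤ w) :
      OneSided p Γ v
  | ax (A : Formula V) : OneSided p (A ::ₘ A.neg ::ₘ 0) 1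
  | emp : OneSided p 0 1
  | efq (Γ : Multiset (Formula V)) : OneSided p Γ 0
  | mix {Γ Δ : Multiset (Formula V)} {v w : ℝ≥0∞} (h₁ : OneSided p Γ v) (h₂ : OneSided p Δ w) :
      OneSided p (Γ + Δ) (v * w)
  | par {A B : Formula V} {Γ : Multiset (Formula V)} {v : ℝ≥0∞}
      (h : OneSided p (A ::ₘ B ::ₘ Γ) v) : OneSided p (A.par B ::ₘ Γ) v
  | tensor {A B : Formula V} {Γ Δ : Multiset (Formula V)} {v w : ℝ≥0∞}
      (h₁ : OneSided p (A ::ₘ Γ) v) (h₂ : OneSided p (B ::ₘ Δ) w) :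
      OneSided p (A.tensor B ::ₘ (Γ + Δ)) (v * w)
  | one : OneSided p (.one ::ₘ 0) 1
  | and {A B : Formula V} {Γ : Multiset (Formula V)} {v w : ℝ≥0∞}
      (h₁ : OneSided p (A ::ₘ Γ) v) (h₂ : OneSided p (B ::ₘ Γ) w) :
      OneSided p (A.and B ::ₘ Γ) (pHarmonicSum p v w)
  | or {A B : Formula V} {Γ : Multiset (Formula V)} {v w : ℝ≥0∞}
      (h₁ : OneSided p (A ::ₘ Γ) v) (h₂ : OneSided p (B ::ₘ Γ) w) :
      OneSided p (A.or B ::ₘ Γ) (pSum p v w)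
  | top (Γ : Multiset (Formula V)) : OneSided p (.top ::ₘ Γ) ∞

/-- `Principal p A Γ v` means that `⊢ A, Γ` is derivable at validity `v` by a logical rule
introducing `A`. -/
inductive Principal (p : ℝ≥0∞) : Formula V → Multiset (Formula V) → ℝ≥0∞ → Prop where
  | par {A B : Formula V} {Γ : Multiset (Formula V)} {v : ℝ≥0∞}
      (h : OneSided p (A ::ₘ B ::ₘ Γ) v) : Principal p (A.par B) Γ v
  | tensor {A B : Formula V} {Γ Δ : Multiset (Formula V)} {v w : ℝ≥0∞}
      (h₁ : OneSided p (A ::ₘ Γ) v) (h₂ : OneSided p (B ::ₘ Δ) w) :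
      Principal p (A.tensor B) (Γ + Δ) (v * w)
  | one : Principal p .one 0 1
  | and {A B : Formula V} {Γ : Multiset (Formula V)} {v w : ℝ≥0∞}
      (h₁ : OneSided p (A ::ₘ Γ) v) (h₂ : OneSided p (B ::ₘ Γ) w) :
      Principal p (A.and B) Γ (pHarmonicSum p v w)
  | or {A B : Formula V} {Γ : Multiset (Formula V)} {v w : ℝ≥0∞}
      (h₁ : OneSided p (A ::ₘ Γ) v) (h₂ : OneSided p (B ::ₘ Γ) w) :
      Principal p (A.or B) Γ (pSum p v w)
  | top (Γ : Multiset (Formula V)) : Principal p .top Γ ∞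

lemma Principal.oneSided {p : ℝ≥0∞} {A : Formula V} {Γ : Multiset (Formula V)} {v : ℝ≥0∞}
    (h : Principal p A Γ v) : OneSided p (A ::ₘ Γ) v := by
  cases h with
  | par h => exact h.par
  | tensor h₁ h₂ => exact h₁.tensor h₂
  | one => exact .one
  | and h₁ h₂ => exact h₁.and h₂
  | or h₁ h₂ => exact h₁.or h₂
  | top => exact .top _

lemma OneSided.congr {p : ℝ≥0∞} {Γ Δ : Multiset (Formula V)} {v w : ℝ≥0∞}
    (h : OneSided p Γ v) (hΓ : Γ = Δ) (hv : w ≤ v) : OneSided p Δ w :=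
  hΓ ▸ h.mono hv

/-- Cuts commute with all rules in which the cut formula is not principal. -/
lemma OneSided.cut_of_principal {p : ℝ≥0∞} (hp : 0 < p) {A : Formula V}
    {Δ : Multiset (Formula V)} {w : ℝ≥0∞} (hΔ : OneSided p (A.neg ::ₘ Δ) w)
    (hA : ∀ Γ v, Principal p A Γ v → OneSided p (Γ + Δ) (v * w))
    {Γ : Multiset (Formula V)} {v : ℝ≥0∞} (hΓ : OneSided p (A ::ₘ Γ) v) :
    OneSided p (Γ + Δ) (v * w) := by
  generalize hΛ : A ::ₘ Γ = Λ at hΓ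
  induction hΓ generalizing Γ with
  | mono _ hvw ih => exact (ih hΛ).mono (mul_le_mul' hvw le_rfl)
  | ax B =>
    rcases Multiset.cons_eq_cons.1 hΛ with ⟨rfl, rfl⟩ | ⟨-, Θ, rfl, h⟩
    -- Cutting against an axiom returns the other premise, as the axiom has the neutral value 1.
    · exact hΔ.congr (by simp) (by simp)
    · obtain ⟨rfl, rfl⟩ : B.neg = A ∧ Θ = 0 := by
        exact (Multiset.singleton_eq_cons_iff Θ).1 h
      exact hΔ.congr (by simp [Formula.neg_neg]) (by simp)
  | emp => simp at hΛ
  -- The value 0 absorbs `w` even when `w = ∞`.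
  | efq => exact (OneSided.efq _).mono (by simp)
  | @mix Γ₁ Γ₂ v₁ v₂ h₁ h₂ ih₁ ih₂ =>
    have hm : A ∈ Γ₁ + Γ₂ := hΛ ▸ Multiset.mem_cons_self _ _
    rcases Multiset.mem_add.1 hm with hm | hm
    · obtain ⟨Θ, rfl⟩ := Multiset.exists_cons_of_mem hm
      obtain rfl : Γ = Θ + Γ₂ := by simpa using hΛ
      exact ((ih₁ rfl).mix h₂).congr (by abel) (by rw [mul_right_comm])
    · obtain ⟨Θ, rfl⟩ := Multiset.exists_cons_of_mem hm
      obtain rfl : Γ = Γ₁ + Θ := by simpa using hΛ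
      exact (h₁.mix (ih₂ rfl)).congr (by abel) (by rw [mul_assoc])
  | @par B C Γ₁ v₁ h ih =>
    rcases Multiset.cons_eq_cons.1 hΛ with ⟨rfl, rfl⟩ | ⟨-, Θ, rfl, rfl⟩
    · exact hA _ _ (.par h)
    · have := ih (Γ := B ::ₘ C ::ₘ Θ) (by simp only [← Multiset.singleton_add]; abel)
      simp only [Multiset.cons_add] at this ⊢
      exact this.par
  | @tensor B C Γ₁ Γ₂ v₁ v₂ h₁ h₂ ih₁ ih₂ =>
    rcases Multiset.cons_eq_cons.1 hΛ with ⟨rfl, rfl⟩ | ⟨-, Θ, rfl, h⟩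
    · exact hA _ _ (.tensor h₁ h₂)
    · have hm : A ∈ Γ₁ + Γ₂ := h ▸ Multiset.mem_cons_self _ _
      rcases Multiset.mem_add.1 hm with hm | hm
      · obtain ⟨Ξ, rfl⟩ := Multiset.exists_cons_of_mem hm
        obtain rfl : Θ = Ξ + Γ₂ := by simpa [eq_comm] using h
        have := ih₁ (Γ := B ::ₘ Ξ) (Multiset.cons_swap _ _ _)
        rw [Multiset.cons_add] at this
        exact (this.tensor h₂).congr (by simp only [← Multiset.singleton_add]; abel)
          (by rw [mul_right_comm])
      · obtain ⟨Ξ, rfl⟩ := Multiset.exists_cons_of_mem hm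
        obtain rfl : Θ = Γ₁ + Ξ := by simpa [eq_comm] using h
        have := ih₂ (Γ := C ::ₘ Ξ) (Multiset.cons_swap _ _ _)
        rw [Multiset.cons_add] at this
        exact (h₁.tensor this).congr (by simp only [← Multiset.singleton_add]; abel)
          (by rw [mul_assoc])
  | one =>
    rcases Multiset.cons_eq_cons.1 hΛ with ⟨rfl, rfl⟩ | ⟨-, Θ, rfl, h⟩
    · exact hA _ _ .one
    · simp at h
  | @and B C Γ₁ v₁ v₂ h₁ h₂ ih₁ ih₂ =>
    rcases Multiset.cons_eq_cons.1 hΛ with ⟨rfl, rfl⟩ | ⟨-, Θ, rfl, rfl⟩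
    · exact hA _ _ (.and h₁ h₂)
    · have h₁' := ih₁ (Γ := B ::ₘ Θ) (Multiset.cons_swap _ _ _)
      have h₂' := ih₂ (Γ := C ::ₘ Θ) (Multiset.cons_swap _ _ _)
      rw [Multiset.cons_add] at h₁' h₂' ⊢
      exact (h₁'.and h₂').mono (pHarmonicSum_mul_le hp _ _ _)
  | @or B C Γ₁ v₁ v₂ h₁ h₂ ih₁ ih₂ =>
    rcases Multiset.cons_eq_cons.1 hΛ with ⟨rfl, rfl⟩ | ⟨-, Θ, rfl, rfl⟩
    · exact hA _ _ (.or h₁ h₂)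
    · have h₁' := ih₁ (Γ := B ::ₘ Θ) (Multiset.cons_swap _ _ _)
      have h₂' := ih₂ (Γ := C ::ₘ Θ) (Multiset.cons_swap _ _ _)
      rw [Multiset.cons_add] at h₁' h₂' ⊢
      exact (h₁'.or h₂').mono (pSum_mul_le hp _ _ _)
  | top Γ₁ =>
    rcases Multiset.cons_eq_cons.1 hΛ with ⟨rfl, rfl⟩ | ⟨-, Θ, rfl, rfl⟩
    · exact hA _ _ (.top _)
    · rw [Multiset.cons_add]
      exact (OneSided.top _).mono le_top

/-- Cuts on `A` are admissible as soon as principal cuts on `A` are. -/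
lemma OneSided.cut_of_principal_principal {p : ℝ≥0∞} (hp : 0 < p) {A : Formula V}
    (hA : ∀ Γ Δ v w, Principal p A Γ v → Principal p A.neg Δ w → OneSided p (Γ + Δ) (v * w))
    {Γ Δ : Multiset (Formula V)} {v w : ℝ≥0∞} (h₁ : OneSided p (A ::ₘ Γ) v)
    (h₂ : OneSided p (A.neg ::ₘ Δ) w) : OneSided p (Γ + Δ) (v * w) := by
  refine OneSided.cut_of_principal hp h₂ (fun Γ' v' h ↦ ?_) h₁
  rw [add_comm, mul_comm]
  -- Second pass, with the premises exchanged: `A.neg` is now the cut formula, and the principal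
  -- proof of `A` is the fixed premise.
  refine OneSided.cut_of_principal hp (by rw [Formula.neg_neg]; exact h.oneSided)
    (fun Δ' w' h' ↦ ?_) h₂
  rw [add_comm, mul_comm]
  exact hA _ _ _ _ h h'

/-- Admissibility of cuts on `A` in the one-sided cut-free calculus. -/
def CutAdmissible (p : ℝ≥0∞) (A : Formula V) : Prop :=
  ∀ ⦃Γ Δ : Multiset (Formula V)⦄ ⦃v w : ℝ≥0∞⦄, OneSided p (A ::ₘ Γ) v →
    OneSided p (A.neg ::ₘ Δ) w → OneSided p (Γ + Δ) (v * w)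

/-- Cut is symmetric in its premises, so only one connective of each dual pair needs treatment. -/
lemma CutAdmissible.neg {p : ℝ≥0∞} {A : Formula V} (h : CutAdmissible p A) :
    CutAdmissible p A.neg := by
  intro Γ Δ v w h₁ h₂
  rw [Formula.neg_neg] at h₂
  rw [add_comm, mul_comm]
  exact h h₂ h₁

lemma CutAdmissible.tensor {p : ℝ≥0∞} (hp : 0 < p) {A B : Formula V} (hA : CutAdmissible p A)
    (hB : CutAdmissible p B) : CutAdmissible p (A.tensor B) := by
  refine fun _ _ _ _ ↦ OneSided.cut_of_principal_principal hp ?_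
  rintro _ Δ _ w (_ | @⟨_, _, Γ₁, Γ₂, v₁, v₂, h₁, h₂⟩) (h | _)
  -- The `⅋` premise contains both negated components: cut `B` first, then cut `A` against the
  -- result.
  have := hB h₂ (h.congr (Multiset.cons_swap _ _ _) le_rfl)
  have := hA h₁ (this.congr (Multiset.add_cons _ _ _) le_rfl)
  exact this.congr (by abel) (by rw [mul_assoc])

lemma CutAdmissible.and {p : ℝ≥0∞} (hp : 0 < p) {A B : Formula V} (hA : CutAdmissible p A)
    (hB : CutAdmissible p B) : CutAdmissible p (A.and B) := by
  refine fun _ _ _ _ ↦ OneSided.cut_of_principal_principal hp ?_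
  intro Γ Δ v w h h'
  cases h with | and h₁ h₂ =>
  cases h' with | @or _ _ _ w₁ w₂ h₁' h₂' =>
  refine OneSided.mono ?_ ((mul_comm _ _).trans_le (pSum_mul_pHarmonicSum_le hp _ _ _ _))
  -- Keep only the component where the maximum is attained, and cut there.
  rcases max_choice (w₁ * _) (w₂ * _) with h | h <;> rw [h, mul_comm]
  · exact hA h₁ h₁'
  · exact hB h₂ h₂'

/-- Cut-elimination for the one-sided calculus. -/
theorem cutAdmissible {p : ℝ≥0∞} (hp : 0 < p) (A : Formula V) : CutAdmissible p A := by
  -- No logical rule introduces `⊥`, so there are no principal cuts; the same holds for literals.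
  have hbot : CutAdmissible p (Formula.bot : Formula V) := fun _ _ _ _ ↦
    OneSided.cut_of_principal_principal hp (by rintro _ _ _ _ ⟨⟩)
  induction A with
  | var a => exact fun _ _ _ _ ↦ OneSided.cut_of_principal_principal hp (by rintro _ _ _ _ ⟨⟩)
  | negVar a => exact fun _ _ _ _ ↦ OneSided.cut_of_principal_principal hp (by rintro _ _ _ _ ⟨⟩)
  | one =>
    refine fun _ _ _ _ ↦ OneSided.cut_of_principal_principal hp ?_
    rintro _ _ _ _ ⟨⟩ ⟨⟩
    exact OneSided.emp.congr (by simp) (by simp)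
  | tensor A B hA hB => exact hA.tensor hp hB
  | par A B hA hB => simpa [Formula.neg, Formula.neg_neg] using (hA.neg.tensor hp hB.neg).neg
  | bot => exact hbot
  | top => exact hbot.neg
  | or A B hA hB => simpa [Formula.neg, Formula.neg_neg] using (hA.neg.and hp hB.neg).neg
  | and A B hA hB => exact hA.and hp hB

/-! ## Comparison with the two-sided calculus -/

/-- `Attains p K v` means that the one-sided translation of the structure `K` has cut-free proofs
combining to a validity at least `v`. -/
def Attains (p : ℝ≥0∞) : SeqStructure (Formula V) → ℝ≥0∞ → Prop
  | .seq s, v => OneSided p (s.antecedent.map Formula.neg + s.consequent) v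
  | .const r, v => v ≤ r
  | .bin c H K, v => ∃ v₁ v₂, Attains p H v₁ ∧ Attains p K v₂ ∧ v ≤ c.eval p v₁ v₂

lemma attains_validity (p : ℝ≥0∞) (H : SeqStructure (Formula V)) (hH : H.Closed) :
    Attains p H (H.validity p hH) := by
  induction H with
  | seq s => exact hH.elim
  | const r => exact le_rfl
  | bin c H K ihH ihK => exact ⟨_, _, ihH hH.1, ihK hH.2, le_rfl⟩

lemma attains_sq {p : ℝ≥0∞} {Γ Δ : Multiset (Formula V)} {v : ℝ≥0∞} :
    Attains p (sq Γ Δ) v ↔ OneSided p (Γ.map Formula.neg + Δ) v := Iff.rfl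

/-- Every rule of `pQLL`, including `CUT`, is sound for cut-free validities. -/
lemma IsInstance.attains {p : ℝ≥0∞} (hp : 0 < p) {n : RuleName}
    {H K : SeqStructure (Formula V)} (h : IsInstance n H K) {v : ℝ≥0∞} (hv : Attains p H v) :
    Attains p K v := by
  cases h with
  | ax A =>
    exact (OneSided.ax A).congr (Multiset.cons_swap _ _ _) hv
  | emp => exact OneSided.emp.congr (by simp) hv
  | efq Γ Δ => exact (OneSided.efq _).mono hv
  | cut A Γ Γ' Δ Δ' =>
    obtain ⟨v₁, v₂, h₁, h₂, hv⟩ := hv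
    rw [attains_sq] at *
    simp only [Multiset.map_cons, Multiset.map_add, Multiset.cons_add, Multiset.add_cons] at *
    exact (cutAdmissible hp A h₁ h₂).congr (by abel) hv
  | mix Γ Γ' Δ Δ' =>
    obtain ⟨v₁, v₂, h₁, h₂, hv⟩ := hv
    rw [attains_sq] at *
    simp only [Multiset.map_add] at *
    exact (h₁.mix h₂).congr (by abel) hv
  -- A left rule translates to the right rule of the dual connective.
  | tensorL A B Γ Δ =>
    rw [attains_sq] at *
    simp only [Multiset.map_cons, Multiset.cons_add, Formula.neg] at *
    exact hv.par
  | parR A B Γ Δ =>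
    rw [attains_sq] at *
    simp only [Multiset.add_cons] at *
    exact hv.par
  | parL A B Γ Γ' Δ Δ' =>
    obtain ⟨v₁, v₂, h₁, h₂, hv⟩ := hv
    rw [attains_sq] at *
    simp only [Multiset.map_cons, Multiset.map_add, Multiset.cons_add, Formula.neg] at *
    exact (h₁.tensor h₂).congr (by congr 1; abel) hv
  | tensorR A B Γ Γ' Δ Δ' =>
    obtain ⟨v₁, v₂, h₁, h₂, hv⟩ := hv
    rw [attains_sq] at *
    simp only [Multiset.map_add, Multiset.add_cons] at *
    exact (h₁.tensor h₂).congr (by congr 1; abel) hv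
  | oneL => exact OneSided.one.congr (by simp [Formula.neg]) hv
  | oneR => exact OneSided.one.congr (by simp) hv
  -- Premise and conclusion of a negation rule have the same translation.
  | negL A Γ Δ =>
    rw [attains_sq] at *
    simpa only [Multiset.map_cons, Multiset.cons_add, Multiset.add_cons, Formula.neg_neg] using hv
  | negR A Γ Δ =>
    rw [attains_sq] at *
    simpa only [Multiset.map_cons, Multiset.cons_add, Multiset.add_cons] using hv
  | orL A B Γ Δ =>
    obtain ⟨v₁, v₂, h₁, h₂, hv⟩ := hv
    rw [attains_sq] at *
    simp only [Multiset.map_cons, Multiset.cons_add, Formula.neg] at *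
    exact (h₁.and h₂).mono hv
  | andR A B Γ Δ =>
    obtain ⟨v₁, v₂, h₁, h₂, hv⟩ := hv
    rw [attains_sq] at *
    simp only [Multiset.add_cons] at *
    exact (h₁.and h₂).mono hv
  | andL A B Γ Δ =>
    obtain ⟨v₁, v₂, h₁, h₂, hv⟩ := hv
    rw [attains_sq] at *
    simp only [Multiset.map_cons, Multiset.cons_add, Formula.neg] at *
    exact (h₁.or h₂).mono hv
  | orR A B Γ Δ =>
    obtain ⟨v₁, v₂, h₁, h₂, hv⟩ := hv
    rw [attains_sq] at *
    simp only [Multiset.add_cons] at *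
    exact (h₁.or h₂).mono hv
  | botL Γ Δ =>
    rw [attains_sq]
    simp only [Multiset.map_cons, Multiset.cons_add, Formula.neg]
    exact (OneSided.top _).mono le_top
  | topR Γ Δ =>
    rw [attains_sq, Multiset.add_cons]
    exact (OneSided.top _).mono le_top

/-- Bounds travel downwards from the top; having `Attains` on composite structures is what lets
composition and the connectives go through. -/
lemma Derivation.attains {p : ℝ≥0∞} (hp : 0 < p) {H K : SeqStructure (Formula V)}
    (d : Derivation (pQLL V) H K) {v : ℝ≥0∞} (hv : Attains p H v) : Attains p K v := by
  induction d generalizing v with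
  | id => exact hv
  | rule r hr => exact IsInstance.attains hp hr.choose_spec hv
  | comp _ _ ih₁ ih₂ => exact ih₂ (ih₁ hv)
  | bin c _ _ ih₁ ih₂ =>
    obtain ⟨v₁, v₂, h₁, h₂, hv⟩ := hv
    exact ⟨v₁, v₂, ih₁ h₁, ih₂ h₂, hv⟩

/-- `K` has a closed derivation in `R` of validity at least `v`. -/
def HasDerivation (p : ℝ≥0∞) {Φ : Type*} (R : Calculus Φ) (K : SeqStructure Φ) (v : ℝ≥0∞) : Prop :=
  ∃ d : ClosedDerivation R K, v ≤ d.validity p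

namespace HasDerivation

variable {Φ : Type*} {p : ℝ≥0∞} {R : Calculus Φ}

lemma mono {K : SeqStructure Φ} {v w : ℝ≥0∞} (h : HasDerivation p R K w) (hvw : v ≤ w) :
    HasDerivation p R K v :=
  h.imp fun _ hd ↦ hvw.trans hd

lemma const (r : ℝ≥0∞) : HasDerivation p R (.const r) r :=
  ⟨⟨.const r, trivial, .id _⟩, le_rfl⟩

lemma bin (c : Connective) {H K : SeqStructure Φ} {v w : ℝ≥0∞} (h₁ : HasDerivation p R H v)
    (h₂ : HasDerivation p R K w) : HasDerivation p R (.bin c H K) (c.eval p v w) := by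
  obtain ⟨d₁, hd₁⟩ := h₁
  obtain ⟨d₂, hd₂⟩ := h₂
  exact ⟨⟨.bin c d₁.top d₂.top, ⟨d₁.closed, d₂.closed⟩, .bin c d₁.derivation d₂.derivation⟩,
    c.eval_mono p hd₁ hd₂⟩

lemma comp {H K : SeqStructure Φ} {v : ℝ≥0∞} (h : HasDerivation p R H v)
    (d : Derivation R H K) : HasDerivation p R K v := by
  obtain ⟨d₁, hd₁⟩ := h
  exact ⟨⟨d₁.top, d₁.closed, d₁.derivation.comp d⟩, hd₁⟩

lemma isInstance {n : RuleName} (hn : n ≠ .cut) {H K : SeqStructure (Formula V)}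
    (h : IsInstance n H K) {v : ℝ≥0∞} (hv : HasDerivation p (cutFreePQLL V) H v) :
    HasDerivation p (cutFreePQLL V) K v :=
  hv.comp (.rule ⟨H, K⟩ ⟨n, hn, h⟩)

lemma of_oneSided {Γ : Multiset (Formula V)} {v : ℝ≥0∞} (h : OneSided p Γ v) :
    HasDerivation p (cutFreePQLL V) (sq 0 Γ) v := by
  induction h with
  | mono _ hvw ih => exact ih.mono hvw
  | ax A =>
    rw [Multiset.cons_swap]
    exact isInstance (by simp) (.negR A 0 (A ::ₘ 0)) (isInstance (by simp) (.ax A) (const 1))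
  | emp => exact isInstance (by simp) .emp (const 1)
  | efq Γ => exact isInstance (by simp) (.efq 0 Γ) (const 0)
  | @mix Γ Δ _ _ _ _ ih₁ ih₂ =>
    exact isInstance (by simp) (.mix 0 0 Γ Δ) (ih₁.bin .tensor ih₂)
  | par _ ih => exact isInstance (by simp) (.parR _ _ _ _) ih
  | @tensor A B Γ Δ _ _ _ _ ih₁ ih₂ =>
    exact isInstance (by simp) (.tensorR A B 0 0 Γ Δ) (ih₁.bin .tensor ih₂)
  | one => exact isInstance (by simp) .oneR (const 1)
  | and _ _ ih₁ ih₂ => exact isInstance (by simp) (.andR _ _ _ _) (ih₁.bin .coadd ih₂)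
  | or _ _ ih₁ ih₂ => exact isInstance (by simp) (.orR _ _ _ _) (ih₁.bin .add ih₂)
  | top Γ => exact isInstance (by simp) (.topR 0 Γ) (const ∞)

/-- Repeated `negL` moves each `A.neg` to the left, where it becomes `A.neg.neg = A`. The antecedent
`Γ'` accumulates the formulae already moved. -/
lemma of_map_neg_add {Γ Γ' Δ : Multiset (Formula V)} {v : ℝ≥0∞}
    (h : HasDerivation p (cutFreePQLL V) (sq Γ' (Γ.map Formula.neg + Δ)) v) :
    HasDerivation p (cutFreePQLL V) (sq (Γ + Γ') Δ) v := by
  induction Γ using Multiset.induction_on generalizing Γ' with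
  | empty => simpa using h
  | cons A Γ ih =>
    rw [Multiset.map_cons, Multiset.cons_add] at h
    have := isInstance (by simp) (.negL _ _ _) h
    rw [Formula.neg_neg] at this
    simpa using ih this

lemma of_attains {K : SeqStructure (Formula V)} {v : ℝ≥0∞} (h : Attains p K v) :
    HasDerivation p (cutFreePQLL V) K v := by
  induction K generalizing v with
  | seq s => simpa using of_map_neg_add (of_oneSided h)
  | const r => exact (const r).mono h
  | bin c H K ihH ihK =>
    obtain ⟨v₁, v₂, h₁, h₂, hv⟩ := h
    exact ((ihH h₁).bin c (ihK h₂)).mono hv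

end HasDerivation

/-- Cut-elimination for closed derivations of arbitrary structures. -/
theorem exists_cutFree_derivation {p : ℝ≥0∞} (hp : 0 < p) {K : SeqStructure (Formula V)}
    (d : ClosedDerivation (pQLL V) K) :
    ∃ d' : ClosedDerivation (cutFreePQLL V) K, d.validity p ≤ d'.validity p :=
  HasDerivation.of_attains (d.derivation.attains hp (attains_validity p d.top d.closed))

/-- Derivations are monotone in the calculus. -/
def Derivation.ofSubset {Φ : Type*} {R S : Calculus Φ} (h : R ⊆ S) {H K : SeqStructure Φ} :
    Derivation R H K → Derivation S H K
  | .id H => .id H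
  | .rule r hr => .rule r (h hr)
  | .comp d₁ d₂ => .comp (d₁.ofSubset h) (d₂.ofSubset h)
  | .bin c d₁ d₂ => .bin c (d₁.ofSubset h) (d₂.ofSubset h)

lemma structProvability_mono (p : ℝ≥0∞) {Φ : Type*} {R S : Calculus Φ} (h : R ⊆ S)
    (K : SeqStructure Φ) : structProvability p R K ≤ structProvability p S K :=
  iSup_le fun d ↦ le_iSup (fun d : ClosedDerivation S K ↦ d.validity p)
    ⟨d.top, d.closed, d.derivation.ofSubset h⟩

lemma cutFreePQLL_union_scheme_cut : cutFreePQLL V ∪ scheme V .cut = pQLL V := by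
  ext r
  constructor
  · rintro (⟨n, -, h⟩ | h)
    exacts [⟨n, h⟩, ⟨_, h⟩]
  · rintro ⟨n, h⟩
    by_cases hn : n = .cut
    · exact .inr (hn ▸ h)
    · exact .inl ⟨n, hn, h⟩

lemma structProvability_cutFreePQLL {p : ℝ≥0∞} (hp : 0 < p) (K : SeqStructure (Formula V)) :
    structProvability p (cutFreePQLL V) K = structProvability p (pQLL V) K := by
  refine (structProvability_mono p (fun _ hr ↦ hr.imp fun _ h ↦ h.2) K).antisymm (iSup_le fun d ↦ ?_)
  obtain ⟨d', hd'⟩ := exists_cutFree_derivation hp d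
  exact hd'.trans (le_iSup (fun d : ClosedDerivation _ K ↦ d.validity p) d')

end QLL

theorem mainTheorem1 {V : Type*} (p : ENNReal) (hp : 0 < p) :
    (∀ Γ Δ : Multiset (QLL.Formula V),
      QLL.provability p (QLL.pQLL V) ⟨Γ, Δ⟩ = QLL.provability p (QLL.cutFreePQLL V) ⟨Γ, Δ⟩) ∧
    QLL.Admissible p (QLL.cutFreePQLL V) (QLL.scheme V .cut) ∧
    (∀ (Γ Δ : Multiset (QLL.Formula V)) (π : QLL.Proof (QLL.pQLL V) ⟨Γ, Δ⟩),
      ∃ π' : QLL.Proof (QLL.cutFreePQLL V) ⟨Γ, Δ⟩, π.validity p ≤ π'.validity p) := by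
  -- `provability` of a sequent unfolds to `structProvability` of its unary structure.
  refine ⟨fun Γ Δ ↦ (QLL.structProvability_cutFreePQLL hp _).symm, fun K ↦ ?_,
    fun Γ Δ π ↦ QLL.exists_cutFree_derivation hp π⟩
  rw [QLL.cutFreePQLL_union_scheme_cut]
  exact QLL.structProvability_cutFreePQLL hp K
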